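/- For a nonnegative integer $N$ write $[N]=\{1,2,\dots,N\}$. An $r$-colouring of $[N]$ is a partition $[N]=C_1\cup\dots\cup C_r$ into $r$ pairwise disjoint (possibly empty) colour classes. A monochromatic solution of $x-y=z^2$ is a triple $(x,y,z)\in C_j^3$, for some $j$, with $x-y=z^2$. (i) (Counting version of Bergelson's theorem.) For every integer $r\ge 1$ there exist a constant $c_r>0$ and a function $\varepsilon_r:\{0,1,2,\dots\}\to\mathbb{R}$ with $\varepsilon_r(N)\to 0$ as $N\to\infty$, both depending only on $r$, such that for every $N$ and every $r$-colouring $C_1\cup\dots\cup C_r=[N]$ there is a colour class $C_j$ with $$\#\{(x,y,z)\in C_j^3 : x-y=z^2\}\ \ge\ c_r\,N^{3/2^r}\,(1-\varepsilon_r(N)).$$ (ii) (The order of magnitude is optimal.) There is an absolute constant $K$ such that for all $r\ge 1$ and all $N$ there is an $r$-colouring of $[N]$ for which the total number of monochromatic solutions of $x-y=z^2$ is at most $K\,N^{3/2^r}$. -/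

import Mathlib

/-- `C 0, …, C (r - 1)` is an `r`-colouring of `[N] = {1, …, N}`: the colour classes are pairwise
disjoint (some may be empty) and their union is `[N]`. -/
def IsColouring {r : ℕ} (N : ℕ) (C : Fin r → Finset ℤ) : Prop :=
  (∀ i j : Fin r, i ≠ j → Disjoint (C i) (C j)) ∧
    Finset.univ.biUnion C = Finset.Icc (1 : ℤ) (N : ℤ)

/-- The number of triples `(x, y, z)` of elements of `A` with `x - y = z ^ 2`. -/
def bergelsonCount (A : Finset ℤ) : ℕ :=
  ((A ×ˢ A ×ˢ A).filter (fun p : ℤ × ℤ × ℤ => p.1 - p.2.1 = p.2.2 ^ 2)).card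

open Finset

/-! Lower bound: induction on the number of colours, for return times of a dense set `A` in a finite
abelian group `G` under translation by `z ^ 2 • g`. Such times have positive density in `[N]`
(`exists_card_returnTimes_ge`), so some colour class has a dense part `B` in `[N]`. Viewing `B` in
`ZMod (2 * N)`, the product of `A` and `B` is again dense (`exists_dense_class_and_product`), and
each of its return times `z ≤ √N` is a return time of `A` for which `x - y = z ^ 2` has `≫ N`
solutions in `B`. If one such `z` has the colour of `B`, that colour has `≫ N` solutions. Otherwise
the remaining colours cover these times, and induction applies with `√N` for `N`, which halves the
exponent. With one colour, `≫ √N` values of `z` give `N ^ (3 / 2)`.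

Recurrence rests on squares forming a van der Corput set (`exists_squareAverage_family`), deduced
from a weak Weyl inequality and fed into Fourier analysis on `G`.

Upper bound: cut `[N]` at `N ^ (1 / 2 ^ j)`. Only the lowest class contains solutions. -/

/-! ### Quadratic exponential sums -/

theorem norm_sum_range_pow_mul_le (w : ℂ) (hw : ‖w‖ = 1) (M : ℕ) :
    ‖w - 1‖ * ‖∑ n ∈ range M, w ^ n‖ ≤ 2 := by
  rw [mul_comm, ← norm_mul, geom_sum_mul]
  calc ‖w ^ M - 1‖ ≤ ‖w ^ M‖ + ‖(1 : ℂ)‖ := norm_sub_le _ _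
    _ = 2 := by rw [norm_pow, hw]; norm_num

theorem norm_sum_range_shift_sub_le (f : ℕ → ℂ) (hf : ∀ n, ‖f n‖ ≤ 1) (M h : ℕ) :
    ‖∑ n ∈ range M, f (n + h) - ∑ n ∈ range M, f n‖ ≤ 2 * h := by
  induction h with
  | zero => simp
  | succ h ih =>
    have key : ∑ n ∈ range M, f (n + (h + 1)) - ∑ n ∈ range M, f (n + h) = f (M + h) - f h := by
      have h1 := Finset.sum_range_sub (fun n => f (n + h)) M
      rw [← Finset.sum_sub_distrib]
      simpa [add_assoc, add_comm, add_left_comm] using h1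
    have h2 : ∑ n ∈ range M, f (n + (h + 1)) - ∑ n ∈ range M, f n
        = (f (M + h) - f h) + (∑ n ∈ range M, f (n + h) - ∑ n ∈ range M, f n) := by
      rw [← key]; ring
    rw [h2]
    have h3 : ‖f (M + h) - f h‖ ≤ 2 := by
      calc _ ≤ ‖f (M + h)‖ + ‖f h‖ := norm_sub_le _ _
        _ ≤ 2 := by linarith [hf (M + h), hf h]
    push_cast
    linarith [norm_add_le (f (M + h) - f h) (∑ n ∈ range M, f (n + h) - ∑ n ∈ range M, f n)]

/-- Van der Corput's inequality with shifts below `H`. -/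
theorem van_der_corput_sum (f : ℕ → ℂ) (hf : ∀ n, ‖f n‖ ≤ 1) (M H : ℕ) :
    H * ‖∑ n ∈ range M, f n‖ ≤
      √(M * ∑ h ∈ range H, ∑ k ∈ range H,
        ‖∑ n ∈ range M, f (n + h) * (starRingEnd ℂ) (f (n + k))‖) + 2 * H ^ 2 := by
  set S := ∑ n ∈ range M, f n
  set T := ∑ n ∈ range M, ∑ h ∈ range H, f (n + h) with hT
  -- Each of the `H` shifted sums differs from `S` by at most `2 * H`.
  have h1 : ‖H * S - T‖ ≤ 2 * H ^ 2 := by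
    have : (H : ℂ) * S - T = ∑ h ∈ range H, (S - ∑ n ∈ range M, f (n + h)) := by
      rw [hT, Finset.sum_comm, Finset.sum_sub_distrib]; simp
    rw [this]
    calc _ ≤ ∑ h ∈ range H, ‖S - ∑ n ∈ range M, f (n + h)‖ := norm_sum_le _ _
      _ ≤ ∑ h ∈ range H, (2 * H : ℝ) := by
        refine Finset.sum_le_sum fun h hh => ?_
        rw [norm_sub_rev]
        refine (norm_sum_range_shift_sub_le f hf M h).trans ?_
        have : (h : ℝ) ≤ H := by exact_mod_cast (mem_range.1 hh).le
        linarith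
      _ = 2 * H ^ 2 := by simp; ring
  have h2 : ‖T‖ ^ 2 ≤ M * ∑ h ∈ range H, ∑ k ∈ range H,
        ‖∑ n ∈ range M, f (n + h) * (starRingEnd ℂ) (f (n + k))‖ := by
    calc ‖T‖ ^ 2 ≤ (∑ n ∈ range M, ‖∑ h ∈ range H, f (n + h)‖) ^ 2 := by
          gcongr; exact norm_sum_le _ _
      _ ≤ M * ∑ n ∈ range M, ‖∑ h ∈ range H, f (n + h)‖ ^ 2 := by
          simpa using sq_sum_le_card_mul_sum_sq (s := range M)
            (f := fun n => ‖∑ h ∈ range H, f (n + h)‖)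
      _ ≤ _ := by
          gcongr
          have : ((∑ n ∈ range M, ‖∑ h ∈ range H, f (n + h)‖ ^ 2 : ℝ) : ℂ) =
              ∑ h ∈ range H, ∑ k ∈ range H,
                ∑ n ∈ range M, f (n + h) * (starRingEnd ℂ) (f (n + k)) := by
            push_cast
            simp_rw [← Complex.mul_conj', map_sum, Finset.sum_mul_sum]
            rw [Finset.sum_comm]
            refine Finset.sum_congr rfl fun h _ => Finset.sum_comm
          calc _ = ‖((∑ n ∈ range M, ‖∑ h ∈ range H, f (n + h)‖ ^ 2 : ℝ) : ℂ)‖ := by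
                rw [Complex.norm_real, Real.norm_of_nonneg (by positivity)]
            _ ≤ _ := by
                rw [this]
                refine (norm_sum_le _ _).trans (Finset.sum_le_sum fun h _ => norm_sum_le _ _)
  have h3 := Real.le_sqrt_of_sq_le h2
  have h4 : (H : ℝ) * ‖S‖ = ‖H * S‖ := by rw [norm_mul]; simp
  rw [h4]
  linarith [norm_le_norm_add_norm_sub' ((H : ℂ) * S) T]

/-- Correlations of the quadratic phase `z ^ ((n + 1) ^ 2)` are geometric sums. -/
theorem norm_sum_quadratic_correlation (z : ℂ) (hz : ‖z‖ = 1) (M h k : ℕ) (hk : k ≤ h) :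
    ‖∑ n ∈ range M, z ^ (n + h + 1) ^ 2 * (starRingEnd ℂ) (z ^ (n + k + 1) ^ 2)‖
      = ‖∑ n ∈ range M, (z ^ (2 * (h - k))) ^ n‖ := by
  obtain ⟨c, rfl⟩ := Nat.exists_eq_add_of_le hk
  have key : ∀ n, z ^ (n + (k + c) + 1) ^ 2 * (starRingEnd ℂ) (z ^ (n + k + 1) ^ 2)
      = z ^ (2 * c * (k + 1) + c ^ 2) * (z ^ (2 * c)) ^ n := by
    intro n
    have : (n + (k + c) + 1) ^ 2 = (n + k + 1) ^ 2 + ((2 * c * (k + 1) + c ^ 2) + 2 * c * n) := by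
      ring
    rw [this, pow_add, mul_right_comm, Complex.mul_conj', norm_pow, hz]
    simp [pow_add, pow_mul]
  simp_rw [key, ← Finset.mul_sum, norm_mul, norm_pow, hz, Nat.add_sub_cancel_left]
  simp

theorem norm_sum_quadratic_correlation_symm (z : ℂ) (M h k : ℕ) :
    ‖∑ n ∈ range M, z ^ (n + h + 1) ^ 2 * (starRingEnd ℂ) (z ^ (n + k + 1) ^ 2)‖ =
    ‖∑ n ∈ range M, z ^ (n + k + 1) ^ 2 * (starRingEnd ℂ) (z ^ (n + h + 1) ^ 2)‖ := by
  rw [← Complex.norm_conj, map_sum]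
  simp [mul_comm]

/-- A weak form of Weyl's inequality for squares: a large quadratic exponential sum forces the
phase to be close to a root of unity of bounded order. -/
theorem exists_pow_near_one_of_large_sum {ε : ℝ} (hε : 0 < ε) :
    ∃ Q : ℕ, 1 ≤ Q ∧ ∀ (M : ℕ) (z : ℂ), 1 ≤ M → ‖z‖ = 1 →
      ε * M < ‖∑ n ∈ range M, z ^ (n + 1) ^ 2‖ →
        ∃ q, 1 ≤ q ∧ q ≤ Q ∧ ‖z ^ q - 1‖ ≤ Q / M := by
  -- `H` makes the van der Corput main term at most half of `ε * M * H`. `Q > 2 * H` admits every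
  -- order `2 * (h - k)`, and `Q > 8 * H / ε` will force the error `2 * H ^ 2` below the other half.
  obtain ⟨H, hH⟩ := exists_nat_gt (8 / ε ^ 2)
  have hH0 : 0 < (H : ℝ) := lt_of_le_of_lt (by positivity) hH
  obtain ⟨Q, hQ⟩ := exists_nat_gt (2 * H + 8 * H / ε)
  have hQ1 : 2 * (H : ℝ) < Q := lt_of_le_of_lt (by linarith [show 0 ≤ 8 * H / ε by positivity]) hQ
  have hQ2 : 8 * H / ε < Q := by linarith
  have hQ0 : 0 < (Q : ℝ) := by linarith
  refine ⟨Q, by exact_mod_cast hQ0, fun M z hM hz hS => ?_⟩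
  by_contra! hcon
  have hM0 : 0 < (M : ℝ) := by exact_mod_cast hM
  -- small `M` is trivial
  have hMbig : 4 * H / ε < M := by
    have h1 := hcon 1 le_rfl (by exact_mod_cast hQ0)
    have h2 : ‖z ^ 1 - 1‖ ≤ 2 := by
      calc _ ≤ ‖z ^ 1‖ + ‖(1 : ℂ)‖ := norm_sub_le _ _
        _ = 2 := by rw [norm_pow, hz]; norm_num
    have h3 : (Q : ℝ) / M < 2 := h1.trans_le h2
    rw [div_lt_iff₀ hM0] at h3
    have : 8 * H / ε = 2 * (4 * H / ε) := by ring
    linarith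
  have hoff' : ∀ h k, h < H → k < h →
      ‖∑ n ∈ range M, z ^ (n + h + 1) ^ 2 * (starRingEnd ℂ) (z ^ (n + k + 1) ^ 2)‖
        ≤ 2 * M / Q := by
    intro h k hh hk
    rw [norm_sum_quadratic_correlation z hz M h k hk.le]
    have hq := hcon (2 * (h - k)) (by omega) (by
      have : 2 * H < Q := by exact_mod_cast hQ1
      omega)
    have hg := norm_sum_range_pow_mul_le (z ^ (2 * (h - k))) (by rw [norm_pow, hz, one_pow]) M
    have h5 : (Q : ℝ) / M * ‖∑ n ∈ range M, (z ^ (2 * (h - k))) ^ n‖ ≤ 2 :=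
      le_trans (by gcongr) hg
    rw [le_div_iff₀ hQ0]
    rw [div_mul_eq_mul_div, div_le_iff₀ hM0] at h5
    linarith
  have hoff : ∀ h ∈ range H, ∀ k ∈ range H,
      ‖∑ n ∈ range M, z ^ (n + h + 1) ^ 2 * (starRingEnd ℂ) (z ^ (n + k + 1) ^ 2)‖
        ≤ 2 * M / Q + if h = k then (M : ℝ) else 0 := by
    intro h hh k hk
    rw [mem_range] at hh hk
    rcases lt_trichotomy h k with hlt | rfl | hlt
    · rw [norm_sum_quadratic_correlation_symm, if_neg hlt.ne, add_zero]
      exact hoff' k h hk hlt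
    · rw [norm_sum_quadratic_correlation z hz M h h le_rfl, if_pos rfl]
      have : 0 ≤ 2 * (M : ℝ) / Q := by positivity
      simp [this]
    · rw [if_neg hlt.ne', add_zero]
      exact hoff' h k hh hlt
  have hsum : ∑ h ∈ range H, ∑ k ∈ range H,
      ‖∑ n ∈ range M, z ^ (n + h + 1) ^ 2 * (starRingEnd ℂ) (z ^ (n + k + 1) ^ 2)‖
        ≤ 2 * H * M := by
    calc _ ≤ ∑ h ∈ range H, ∑ k ∈ range H, (2 * M / Q + if h = k then (M : ℝ) else 0) :=
          Finset.sum_le_sum fun h hh => Finset.sum_le_sum fun k hk => hoff h hh k hk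
      _ = H * (H * (2 * M / Q)) + H * M := by
          simp only [Finset.sum_add_distrib, Finset.sum_const, card_range, nsmul_eq_mul]
          congr 1
          rw [Finset.sum_congr rfl (g := fun _ => (M : ℝ))]
          · simp
          · intro h hh; simp [mem_range.1 hh]
      _ ≤ 2 * H * M := by
          have : H * (2 * M / Q) ≤ (M : ℝ) := by
            rw [mul_div_assoc', div_le_iff₀ hQ0]; nlinarith
          nlinarith
  have hv := van_der_corput_sum (fun n => z ^ (n + 1) ^ 2) (fun n => by simp [hz]) M H
  have hsq : √(M * ∑ h ∈ range H, ∑ k ∈ range H,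
      ‖∑ n ∈ range M, z ^ (n + h + 1) ^ 2 * (starRingEnd ℂ) (z ^ (n + k + 1) ^ 2)‖)
        ≤ ε * M * H / 2 := by
    apply Real.sqrt_le_iff.2 ⟨by positivity, ?_⟩
    calc _ ≤ (M : ℝ) * (2 * H * M) := by gcongr
      _ ≤ _ := by
        rw [div_lt_iff₀ (by positivity)] at hH
        have : (ε * M * H / 2) ^ 2 - M * (2 * H * M) = M ^ 2 * H / 4 * (H * ε ^ 2 - 8) := by ring
        have : 0 ≤ (M : ℝ) ^ 2 * H / 4 * (H * ε ^ 2 - 8) :=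
          mul_nonneg (by positivity) (by linarith)
        linarith
  rw [div_lt_iff₀ hε] at hMbig
  have : H * (ε * M) < H * ‖∑ n ∈ range M, z ^ (n + 1) ^ 2‖ := by gcongr
  nlinarith

/-! ### Squares as a van der Corput set -/

/-- The average of `Re z ^ (m ^ 2)` over the first `M` positive multiples `m` of `D`. -/
noncomputable def squareAverage (D M : ℕ) (z : ℂ) : ℝ :=
  (∑ n ∈ range M, (z ^ (D * (n + 1)) ^ 2).re) / M

theorem neg_one_le_squareAverage (D M : ℕ) (z : ℂ) (hz : ‖z‖ = 1) :
    -1 ≤ squareAverage D M z := by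
  rcases Nat.eq_zero_or_pos M with rfl | hM
  · simp [squareAverage]
  have hM0 : 0 < (M : ℝ) := by exact_mod_cast hM
  rw [squareAverage, le_div_iff₀ hM0]
  calc (-1 : ℝ) * M = ∑ n ∈ range M, (-1 : ℝ) := by simp
    _ ≤ _ := Finset.sum_le_sum fun n _ => by
      have := Complex.abs_re_le_norm (z ^ (D * (n + 1)) ^ 2)
      rw [norm_pow, hz, one_pow] at this
      exact (abs_le.1 this).1

theorem norm_pow_sub_one_le (z : ℂ) (hz : ‖z‖ = 1) (n : ℕ) : ‖z ^ n - 1‖ ≤ n * ‖z - 1‖ := by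
  rw [← mul_geom_sum, norm_mul, mul_comm]
  gcongr
  calc _ ≤ ∑ i ∈ range n, ‖z ^ i‖ := norm_sum_le _ _
    _ = n := by simp [hz]

/-- Each exponent is `a * (n + 1) ^ 2` times `D ^ 2 * q`, so every term lies within `1` of `1` and
has nonnegative real part. -/
theorem squareAverage_nonneg_of_pow_near_one {D D' M' q a : ℕ} {z : ℂ} (hz : ‖z‖ = 1) {δ : ℝ}
    (hq : ‖(z ^ D ^ 2) ^ q - 1‖ ≤ δ) (ha : D' ^ 2 = D ^ 2 * q * a) (hδ : a * M' ^ 2 * δ ≤ 1) :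
    0 ≤ squareAverage D' M' z := by
  have hδ0 : 0 ≤ δ := (norm_nonneg _).trans hq
  refine div_nonneg (Finset.sum_nonneg fun n hn => ?_) (by positivity)
  have h1 : z ^ (D' * (n + 1)) ^ 2 = ((z ^ D ^ 2) ^ q) ^ (a * (n + 1) ^ 2) := by
    rw [mul_pow, ha, ← pow_mul, ← pow_mul]; ring_nf
  have h2 := norm_pow_sub_one_le ((z ^ D ^ 2) ^ q) (by simp [hz]) (a * (n + 1) ^ 2)
  rw [← h1] at h2
  have h3 : ((n : ℝ) + 1) ≤ M' := by exact_mod_cast mem_range.1 hn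
  have h4 : ‖z ^ (D' * (n + 1)) ^ 2 - 1‖ ≤ 1 := by
    refine h2.trans (le_trans ?_ hδ)
    push_cast
    gcongr
  have h5 := (abs_le.1 ((Complex.abs_re_le_norm _).trans h4)).1
  simp at h5
  linarith

/-- The squares form a van der Corput set: for a family of averages along dilated squares, no
point of the unit circle makes the total substantially negative. -/
theorem exists_squareAverage_family {ε : ℝ} (hε : 0 < ε) (J : ℕ) :
    ∃ D M : ℕ → ℕ, (∀ j, 1 ≤ D j) ∧ (∀ j, 1 ≤ M j) ∧
      ∀ z : ℂ, ‖z‖ = 1 → -(ε * J + 1) ≤ ∑ j ∈ range J, squareAverage (D j) (M j) z := by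
  obtain ⟨Q, hQ1, hQ⟩ := exists_pow_near_one_of_large_sum hε
  -- The dilations grow while the lengths shrink. `B` absorbs `Q` and the quotient of dilations;
  -- since `1 + 2 * 3 ^ k ≤ 3 ^ (k + 1)`, each length is at least `B` times the square of any later
  -- one.
  set B := Q * Q.factorial ^ (2 * J) with hB
  have hf : 1 ≤ Q.factorial := Nat.factorial_pos Q
  have hB1 : 1 ≤ B := Nat.mul_pos hQ1 (pow_pos hf _)
  refine ⟨fun j => Q.factorial ^ j, fun j => B ^ 3 ^ (J - j), fun j => Nat.one_le_pow _ _ hf,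
    fun j => Nat.one_le_pow _ _ hB1, fun z hz => ?_⟩
  set W : ℕ → ℝ := fun j => squareAverage (Q.factorial ^ j) (B ^ 3 ^ (J - j)) z with hW
  -- A very negative average at `i` puts `z ^ (D i) ^ 2` near a root of unity of order `q ≤ Q`.
  -- Later dilations contain the factor `q`, which removes the oscillation.
  have hbad : ∀ i j, i < j → j < J → W i < -ε → 0 ≤ W j := by
    intro i j hij hj hi
    have hMi : 1 ≤ B ^ 3 ^ (J - i) := Nat.one_le_pow _ _ hB1
    have hMi0 : 0 < ((B ^ 3 ^ (J - i) : ℕ) : ℝ) := by exact_mod_cast hMi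
    obtain ⟨q, hq1, hqQ, hq⟩ := hQ (B ^ 3 ^ (J - i)) (z ^ (Q.factorial ^ i) ^ 2) hMi
      (by simp [hz]) (by
        simp only [hW, squareAverage] at hi
        rw [div_lt_iff₀ hMi0] at hi
        have h1 : (∑ n ∈ range (B ^ 3 ^ (J - i)), (z ^ (Q.factorial ^ i) ^ 2) ^ (n + 1) ^ 2).re
            = ∑ n ∈ range (B ^ 3 ^ (J - i)), (z ^ (Q.factorial ^ i * (n + 1)) ^ 2).re := by
          rw [Complex.re_sum]
          simp_rw [mul_pow, pow_mul]
        have h2 := (abs_le.1 (Complex.abs_re_le_norm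
          (∑ n ∈ range (B ^ 3 ^ (J - i)), (z ^ (Q.factorial ^ i) ^ 2) ^ (n + 1) ^ 2))).1
        rw [h1] at h2
        linarith)
    obtain ⟨b, hb⟩ := Nat.dvd_factorial hq1 hqQ
    obtain ⟨d, rfl⟩ := Nat.exists_eq_add_of_lt hij
    refine squareAverage_nonneg_of_pow_near_one (a := b * Q.factorial ^ (2 * d + 1)) hz hq
      (by
        calc (Q.factorial ^ (i + d + 1)) ^ 2
            = (Q.factorial ^ i) ^ 2 * Q.factorial * Q.factorial ^ (2 * d + 1) := by ring
          _ = (Q.factorial ^ i) ^ 2 * (q * b) * Q.factorial ^ (2 * d + 1) := by rw [← hb]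
          _ = _ := by ring) ?_
    have hbQ : b ≤ Q.factorial := hb ▸ Nat.le_mul_of_pos_left b hq1
    have hnat : b * Q.factorial ^ (2 * d + 1) * (B ^ 3 ^ (J - (i + d + 1))) ^ 2 * Q
        ≤ B ^ 3 ^ (J - i) := by
      calc b * Q.factorial ^ (2 * d + 1) * (B ^ 3 ^ (J - (i + d + 1))) ^ 2 * Q
          ≤ Q.factorial * Q.factorial ^ (2 * d + 1) * (B ^ 3 ^ (J - (i + d + 1))) ^ 2 * Q := by
            gcongr
        _ = Q * Q.factorial ^ (2 * d + 2) * (B ^ 3 ^ (J - (i + d + 1))) ^ 2 := by ring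
        _ ≤ B * (B ^ 3 ^ (J - (i + d + 1))) ^ 2 := by
            gcongr
            rw [hB]
            gcongr
            omega
        _ = B ^ (1 + 2 * 3 ^ (J - (i + d + 1))) := by ring
        _ ≤ B ^ 3 ^ (J - i) := by
            apply Nat.pow_le_pow_right hB1
            have h1 : J - i = (J - (i + d + 1)) + (d + 1) := by omega
            have h2 : 3 ^ (J - (i + d + 1) + 1) ≤ 3 ^ (J - i) :=
              Nat.pow_le_pow_right (by norm_num) (by omega)
            have h3 : 1 ≤ 3 ^ (J - (i + d + 1)) := Nat.one_le_pow _ _ (by norm_num)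
            rw [pow_succ] at h2
            omega
    rw [mul_div_assoc', div_le_one hMi0]
    exact_mod_cast hnat
  -- Hence at most one index is bad, and it costs at most `1`.
  have hcard : (#{j ∈ range J | W j < -ε}) ≤ 1 := by
    rw [Finset.card_le_one]
    intro i hi j hj
    simp only [mem_filter, mem_range] at hi hj
    rcases lt_trichotomy i j with h | h | h
    · linarith [hbad i j h hj.1 hi.2]
    · exact h
    · linarith [hbad j i h hi.1 hj.2]
  calc -(ε * J + 1) ≤ ∑ j ∈ range J, (-ε - if W j < -ε then (1 : ℝ) else 0) := by
        rw [Finset.sum_sub_distrib, ← Finset.sum_filter]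
        simp only [sum_const, card_range, nsmul_eq_mul, mul_one]
        have : ((#{j ∈ range J | W j < -ε} : ℕ) : ℝ) ≤ 1 := by exact_mod_cast hcard
        linarith
    _ ≤ _ := Finset.sum_le_sum fun j _ => by
        split_ifs with h
        · linarith [neg_one_le_squareAverage (Q.factorial ^ j) (B ^ 3 ^ (J - j)) z hz]
        · simpa using h

/-! ### Recurrence along squares in finite abelian groups -/

/-- The number of `x ∈ A` that return to `A` after translation by `d`. -/
def returnCount {G : Type*} [Add G] [DecidableEq G] (A : Finset G) (d : G) : ℕ :=
  #{x ∈ A | x + d ∈ A}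

section Fourier

variable {G : Type*} [AddCommGroup G] [Fintype G] [DecidableEq G]

/-- Expanding the square, orthogonality of characters retains only the pairs with `y = x + d`. -/
theorem sum_addChar_sq_mul_eq (A : Finset G) (d : G) :
    ∑ χ : AddChar G ℂ, ‖∑ x ∈ A, χ x‖ ^ 2 * (χ d).re = Fintype.card G * returnCount A d := by
  have h1 : ∑ χ : AddChar G ℂ, ((‖∑ x ∈ A, χ x‖ : ℂ) ^ 2 * χ d)
      = (Fintype.card G : ℂ) * returnCount A d := by
    have h2 : ∀ χ : AddChar G ℂ, ((‖∑ x ∈ A, χ x‖ : ℂ) ^ 2 * χ d)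
        = ∑ x ∈ A, ∑ y ∈ A, χ (x + d - y) := by
      intro χ
      rw [← Complex.mul_conj', map_sum, Finset.sum_mul_sum, Finset.sum_mul]
      refine Finset.sum_congr rfl fun x _ => ?_
      rw [Finset.sum_mul]
      refine Finset.sum_congr rfl fun y _ => ?_
      rw [sub_eq_add_neg, AddChar.map_add_eq_mul, AddChar.map_add_eq_mul,
        AddChar.map_neg_eq_conj]
      ring
    simp_rw [h2]
    rw [Finset.sum_comm]
    simp_rw [Finset.sum_comm (s := (univ : Finset (AddChar G ℂ))), AddChar.sum_apply_eq_ite,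
      sub_eq_zero]
    rw [returnCount, Finset.card_filter]
    push_cast
    rw [Finset.mul_sum]
    refine Finset.sum_congr rfl fun x _ => ?_
    simp [Finset.sum_ite_eq]
  have h3 := congrArg Complex.re h1
  rw [Complex.re_sum] at h3
  have h4 : ((Fintype.card G : ℂ) * returnCount A d).re = Fintype.card G * returnCount A d := by
    norm_cast
  rw [h4] at h3
  rw [← h3]
  refine Finset.sum_congr rfl fun χ _ => ?_
  rw [← Complex.ofReal_pow, Complex.re_ofReal_mul]

theorem sum_addChar_sq_eq (A : Finset G) :
    ∑ χ : AddChar G ℂ, ‖∑ x ∈ A, χ x‖ ^ 2 = Fintype.card G * #A := by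
  have := sum_addChar_sq_mul_eq A 0
  simpa [returnCount] using this

end Fourier

/-- Uniform recurrence along squares for translations of finite abelian groups. -/
theorem exists_returnCount_sq_ge {δ : ℝ} (hδ : 0 < δ) :
    ∃ K : ℕ, 1 ≤ K ∧ ∀ (G : Type) [AddCommGroup G] [Fintype G] [DecidableEq G] (A : Finset G)
      (g : G), δ * Fintype.card G ≤ #A →
        ∃ m, 1 ≤ m ∧ m ≤ K ∧ δ ^ 2 / 2 * Fintype.card G ≤ returnCount A (m ^ 2 • g) := by
  obtain ⟨J, hJ⟩ := exists_nat_gt (4 / δ)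
  have hJ0 : 0 < (J : ℝ) := lt_trans (by positivity) hJ
  -- With `ε = δ / 4` and `J > 4 / δ`, the loss `ε * J + 1` is below `δ * J / 2`, half of what the
  -- trivial character guarantees.
  obtain ⟨D, M, hD, hM, hW⟩ := exists_squareAverage_family (show 0 < δ / 4 by positivity) J
  refine ⟨1 + ∑ j ∈ range J, D j * M j, by omega, fun G _ _ _ A g hA => ?_⟩
  by_contra! hcon
  have hG : 0 < (Fintype.card G : ℝ) := by exact_mod_cast Fintype.card_pos
  set S : AddChar G ℂ → ℝ := fun χ => ‖∑ x ∈ A, χ x‖ ^ 2 with hS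
  have hS0 : ∀ χ, 0 ≤ S χ := fun χ => by positivity
  have havg : ∀ j ∈ range J,
      ∑ χ, S χ * squareAverage (D j) (M j) (χ g) ≤ δ ^ 2 / 2 * (Fintype.card G : ℝ) ^ 2 := by
    intro j hj
    have hMj : 0 < (M j : ℝ) := by exact_mod_cast hM j
    simp_rw [squareAverage, mul_div_assoc', ← Finset.sum_div, Finset.mul_sum]
    rw [Finset.sum_comm, div_le_iff₀ hMj]
    calc _ ≤ ∑ n ∈ range (M j), δ ^ 2 / 2 * (Fintype.card G : ℝ) ^ 2 := by
          refine Finset.sum_le_sum fun n hn => ?_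
          have h1 := sum_addChar_sq_mul_eq A ((D j * (n + 1)) ^ 2 • g)
          simp_rw [AddChar.map_nsmul_eq_pow] at h1
          simp only [hS]
          rw [h1]
          have h2 : D j * (n + 1) ≤ 1 + ∑ j ∈ range J, D j * M j := by
            calc D j * (n + 1) ≤ D j * M j := by gcongr; exact mem_range.1 hn
              _ ≤ ∑ j ∈ range J, D j * M j :=
                Finset.single_le_sum (f := fun j => D j * M j) (fun _ _ => Nat.zero_le _) hj
              _ ≤ _ := by omega
          have h3 := hcon _ (Nat.mul_pos (hD j) n.succ_pos) h2
          nlinarith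
      _ = _ := by simp; ring
  have hup : ∑ χ, S χ * ∑ j ∈ range J, squareAverage (D j) (M j) (χ g)
      ≤ J * (δ ^ 2 / 2 * (Fintype.card G : ℝ) ^ 2) := by
    simp_rw [Finset.mul_sum]
    rw [Finset.sum_comm]
    refine (Finset.sum_le_sum havg).trans ?_
    simp
  have hone : ∑ j ∈ range J, squareAverage (D j) (M j) ((1 : AddChar G ℂ) g) = J := by
    have : ∀ j ∈ range J, squareAverage (D j) (M j) ((1 : AddChar G ℂ) g) = 1 := by
      intro j _
      have hMj : (M j : ℝ) ≠ 0 := by have := hM j; positivity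
      simp [squareAverage, hMj]
    rw [Finset.sum_congr rfl this]; simp
  have hlow : (#A : ℝ) ^ 2 * J - (δ / 4 * J + 1) * (Fintype.card G * #A)
      ≤ ∑ χ, S χ * ∑ j ∈ range J, squareAverage (D j) (M j) (χ g) := by
    rw [← sum_addChar_sq_eq, Finset.mul_sum]
    have h1 : (#A : ℝ) ^ 2 * J = ∑ χ : AddChar G ℂ, if χ = 1 then S χ * J else 0 := by
      rw [Finset.sum_ite_eq' univ (1 : AddChar G ℂ)]
      simp [hS]
    rw [h1, ← Finset.sum_sub_distrib]
    refine Finset.sum_le_sum fun χ _ => ?_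
    have h2 := hW (χ g) (AddChar.norm_apply χ g)
    have h3 := hS0 χ
    change _ - _ * S χ ≤ _
    split_ifs with h
    · subst h
      rw [hone]
      have : 0 ≤ (δ / 4 * J + 1) * S 1 := by positivity
      linarith
    · nlinarith
  rw [div_lt_iff₀ hδ] at hJ
  have hA0 : 0 < (#A : ℝ) := lt_of_lt_of_le (by positivity) hA
  have e1 : 0 < (J : ℝ) * δ / 2 - 1 - J * δ / 4 := by nlinarith
  have e2 : (J : ℝ) * δ / 2 * Fintype.card G < J * #A - (δ / 4 * J + 1) * Fintype.card G := by
    have : (J : ℝ) * (δ * Fintype.card G) ≤ J * #A := by gcongr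
    nlinarith
  have e3 : (δ * Fintype.card G) * ((J : ℝ) * δ / 2 * Fintype.card G) <
      #A * (J * #A - (δ / 4 * J + 1) * Fintype.card G) := by
    have : (0:ℝ) < (J : ℝ) * δ / 2 * Fintype.card G := by positivity
    exact mul_lt_mul' hA e2 this.le hA0
  nlinarith

/-- A positive proportion of all `z ≤ N` are square return times. -/
theorem exists_card_returnTimes_ge {δ : ℝ} (hδ : 0 < δ) :
    ∃ κ : ℝ, 0 < κ ∧ ∃ N₀ : ℕ, ∀ (G : Type) [AddCommGroup G] [Fintype G] [DecidableEq G]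
      (A : Finset G) (g : G), δ * Fintype.card G ≤ #A → ∀ N, N₀ ≤ N →
        κ * N ≤
          #{z ∈ Icc 1 N | δ ^ 2 / 2 * Fintype.card G ≤ (returnCount A (z ^ 2 • g) : ℝ)} := by
  classical
  obtain ⟨K, hK, h⟩ := exists_returnCount_sq_ge hδ
  have hK0 : 0 < (K : ℝ) := by exact_mod_cast hK
  refine ⟨1 / (2 * K ^ 2), by positivity, K, fun G _ _ _ A g hA N hN => ?_⟩
  -- Recurrence for the step `t ^ 2 • g` gives the return time `t * m t` for `g`. Since `m t ≤ K`,
  -- each value arises from at most `K` choices of `t`.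
  choose m hm1 hmK hm using fun t : ℕ => h G A (t ^ 2 • g) hA
  set R := {z ∈ Icc 1 N | δ ^ 2 / 2 * Fintype.card G ≤ (returnCount A (z ^ 2 • g) : ℝ)}
  have hsub : (Icc 1 (N / K)).image (fun t => t * m t) ⊆ R := by
    intro z hz
    simp only [mem_image, mem_Icc] at hz
    obtain ⟨t, ⟨ht1, ht2⟩, rfl⟩ := hz
    simp only [R, mem_filter, mem_Icc]
    refine ⟨⟨Nat.mul_pos ht1 (hm1 t), ?_⟩, ?_⟩
    · calc t * m t ≤ N / K * K := Nat.mul_le_mul ht2 (hmK t)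
        _ ≤ N := Nat.div_mul_le_self N K
    · have := hm t
      rwa [← mul_nsmul, ← mul_pow] at this
  have hfib := Finset.card_le_mul_card_image (f := fun t => t * m t) (Icc 1 (N / K)) K (by
    intro z hz
    simp only [mem_image, mem_Icc] at hz
    calc _ ≤ #(Icc 1 K) := by
          refine Finset.card_le_card_of_injOn m (fun t _ => by simp [hm1 t, hmK t]) ?_
          intro t ht s hs hts
          simp only [coe_filter, Set.mem_ofPred_eq, mem_Icc] at ht hs
          have : t * m t = s * m t := by rw [ht.2, hts, hs.2]
          exact Nat.eq_of_mul_eq_mul_right (hm1 t) this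
      _ = K := by simp)
  have h1 : N / K ≤ K * #R := by
    simpa using hfib.trans (Nat.mul_le_mul_left K (Finset.card_le_card hsub))
  have h2 : N ≤ 2 * K * (N / K) := by
    have h3 := Nat.div_add_mod N K
    have h4 := Nat.mod_lt N hK
    have h5 : K * 1 ≤ K * (N / K) := Nat.mul_le_mul_left K (Nat.div_pos hN hK)
    nlinarith
  have h3 : N ≤ 2 * K ^ 2 * #R := by
    calc N ≤ 2 * K * (N / K) := h2
      _ ≤ 2 * K * (K * #R) := by gcongr
      _ = _ := by ring
  have h4 : (N : ℝ) ≤ 2 * K ^ 2 * #R := by exact_mod_cast h3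
  rw [div_mul_eq_mul_div, one_mul, div_le_iff₀ (by positivity)]
  linarith

/-! ### Products with colour classes -/

theorem returnCount_prod {G H : Type*} [Add G] [Add H] [DecidableEq G] [DecidableEq H]
    (A : Finset G) (B : Finset H) (d : G) (e : H) :
    returnCount (A ×ˢ B) (d, e) = returnCount A d * returnCount B e := by
  rw [returnCount, returnCount, returnCount, ← Finset.card_product]
  congr 1
  ext ⟨x, y⟩
  simp only [mem_filter, mem_product, Prod.mk_add_mk]
  tauto

theorem returnCount_le_card {G : Type*} [Add G] [Fintype G] [DecidableEq G]
    (A : Finset G) (d : G) : returnCount A d ≤ Fintype.card G :=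
  Finset.card_le_univ _

/-- Reduction modulo `2 N` is injective on `[1, 2 N]`. -/
theorem eq_of_zmod_cast_eq {N : ℕ} {x y : ℤ} (hx : x ∈ Icc (1 : ℤ) (2 * N))
    (hy : y ∈ Icc (1 : ℤ) (2 * N)) (h : (x : ZMod (2 * N)) = y) : x = y := by
  rw [ZMod.intCast_eq_intCast_iff_dvd_sub] at h
  rw [mem_Icc] at hx hy
  have := Int.eq_zero_of_abs_lt_dvd h (by rw [abs_lt]; push_cast; constructor <;> omega)
  omega

theorem card_image_zmod_cast {N : ℕ} {B : Finset ℤ} (hB : B ⊆ Icc (1 : ℤ) N) :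
    #(B.image (fun x : ℤ => (x : ZMod (2 * N)))) = #B := by
  refine Finset.card_image_of_injOn fun x hx y hy hxy => ?_
  have h1 := mem_Icc.1 (hB hx)
  have h2 := mem_Icc.1 (hB hy)
  exact eq_of_zmod_cast_eq (mem_Icc.2 (by omega)) (mem_Icc.2 (by omega)) hxy

/-- For `x, z ^ 2 ≤ N` the sum `x + z ^ 2` is at most `2 * N`, so modulus `2 * N` creates no
wraparound solutions. -/
theorem returnCount_image_zmod_cast_le {N z : ℕ} {B : Finset ℤ} (hB : B ⊆ Icc (1 : ℤ) N)
    (hz : z ^ 2 ≤ N) :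
    returnCount (B.image (fun x : ℤ => (x : ZMod (2 * N)))) (z ^ 2 • (1 : ZMod (2 * N)))
      ≤ returnCount B ((z : ℤ) ^ 2) := by
  rw [returnCount, returnCount]
  refine le_trans (Finset.card_le_card (t := image (fun x : ℤ => (x : ZMod (2 * N)))
    {x ∈ B | x + (z : ℤ) ^ 2 ∈ B}) ?_) Finset.card_image_le
  intro u hu
  simp only [mem_filter, mem_image] at hu ⊢
  obtain ⟨⟨x, hx, rfl⟩, y, hy, hxy⟩ := hu
  refine ⟨x, ⟨hx, ?_⟩, rfl⟩
  have h1 := mem_Icc.1 (hB hx)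
  have h2 := mem_Icc.1 (hB hy)
  have hz' : (z : ℤ) ^ 2 ≤ N := by exact_mod_cast hz
  have hz0 : 0 ≤ (z : ℤ) ^ 2 := by positivity
  have : y = x + (z : ℤ) ^ 2 := by
    refine eq_of_zmod_cast_eq (N := N) (mem_Icc.2 (by omega)) (mem_Icc.2 (by omega)) ?_
    rw [hxy]; simp
  rwa [← this]

theorem sum_returnCount_le_bergelsonCount (C B : Finset ℤ) (hB : B ⊆ C) (Z : Finset ℕ)
    (hZ : ∀ z ∈ Z, (z : ℤ) ∈ C) :
    ∑ z ∈ Z, returnCount B ((z : ℤ) ^ 2) ≤ bergelsonCount C := by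
  simp_rw [returnCount, ← Finset.card_sigma]
  refine Finset.card_le_card_of_injOn
    (fun p : (_ : ℕ) × ℤ => (p.2 + (p.1 : ℤ) ^ 2, p.2, (p.1 : ℤ))) ?_ ?_
  · rintro ⟨z, x⟩ h
    simp only [coe_sigma, Set.mem_sigma_iff, mem_coe, mem_filter] at h
    simp only [coe_filter, Set.mem_ofPred_eq, mem_product]
    exact ⟨⟨hB h.2.2, hB h.2.1, hZ z h.1⟩, by ring⟩
  · rintro ⟨z, x⟩ _ ⟨z', x'⟩ _ h
    simp only [Prod.mk.injEq, Nat.cast_inj] at h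
    obtain ⟨_, rfl, rfl⟩ := h
    rfl

/-- If the square return times of a dense set are covered by `s.card` sets, one of them is dense,
and the product of the two dense sets records their common return times. -/
theorem exists_dense_class_and_product {δ : ℝ} (hδ : 0 < δ) (r : ℕ) (hr : 1 ≤ r) :
    ∃ δ' : ℝ, 0 < δ' ∧ ∃ N₀ : ℕ, 1 ≤ N₀ ∧ ∀ (G : Type) [AddCommGroup G] [Fintype G] [DecidableEq G]
      (A : Finset G) (g : G), δ * Fintype.card G ≤ #A → ∀ N, N₀ ≤ N →
      ∀ (ι : Type) (s : Finset ι) (C : ι → Finset ℤ), #s = r →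
      (∀ z ∈ Icc 1 N, δ ^ 2 / 2 * Fintype.card G ≤ (returnCount A (z ^ 2 • g) : ℝ) →
        ∃ j ∈ s, (z : ℤ) ∈ C j) →
      ∃ j ∈ s, ∃ (G' : Type) (_ : AddCommGroup G') (_ : Fintype G') (_ : DecidableEq G')
        (A' : Finset G') (g' : G'), δ' * Fintype.card G' ≤ #A' ∧
        ∃ B ⊆ C j, ∀ z : ℕ, z ^ 2 ≤ N → ∀ θ : ℝ,
          θ * Fintype.card G' ≤ returnCount A' (z ^ 2 • g') →
          θ * Fintype.card G ≤ returnCount A (z ^ 2 • g) ∧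
            θ * N ≤ returnCount B ((z : ℤ) ^ 2) := by
  classical
  obtain ⟨κ, hκ, N₀, h⟩ := exists_card_returnTimes_ge hδ
  have hr0 : 0 < (r : ℝ) := by exact_mod_cast hr
  refine ⟨δ * (κ / (2 * r)), by positivity, N₀ + 1, by omega, fun G _ _ _ A g hA N hN ι s C hs hcov
    => ?_⟩
  have hcard := h G A g hA N (by omega)
  set R := {z ∈ Icc 1 N | δ ^ 2 / 2 * Fintype.card G ≤ (returnCount A (z ^ 2 • g) : ℝ)} with hR
  set B : ι → Finset ℤ := fun j => C j ∩ Icc (1 : ℤ) N with hB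
  have hle : #R ≤ ∑ j ∈ s, #(B j) := by
    have h1 : R.image (fun z : ℕ => (z : ℤ)) ⊆ s.biUnion B := by
      intro u hu
      obtain ⟨z, hz, rfl⟩ := mem_image.1 hu
      rw [hR, mem_filter] at hz
      obtain ⟨j, hj, hzj⟩ := hcov z hz.1 hz.2
      have := mem_Icc.1 hz.1
      refine mem_biUnion.2 ⟨j, hj, mem_inter.2 ⟨hzj, mem_Icc.2 (by omega)⟩⟩
    have h2 := (Finset.card_le_card h1).trans Finset.card_biUnion_le
    rwa [Finset.card_image_of_injective _ Nat.cast_injective] at h2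
  have hsne : s.Nonempty := Finset.card_pos.1 (by omega)
  obtain ⟨j, hj, hBj⟩ : ∃ j ∈ s, κ * N / r ≤ #(B j) := by
    refine Finset.exists_le_of_sum_le hsne ?_
    rw [Finset.sum_const, hs, nsmul_eq_mul, mul_div_cancel₀ _ hr0.ne']
    exact hcard.trans (by exact_mod_cast hle)
  have hN1 : 1 ≤ N := by omega
  have hNR : 0 < (N : ℝ) := by exact_mod_cast hN1
  have : NeZero (2 * N) := ⟨by omega⟩
  have hBsub : B j ⊆ Icc (1 : ℤ) N := Finset.inter_subset_right
  have hcG : (Fintype.card (G × ZMod (2 * N)) : ℝ) = Fintype.card G * (2 * N) := by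
    rw [Fintype.card_prod, ZMod.card]; push_cast; ring
  have hG : 0 < (Fintype.card G : ℝ) := by exact_mod_cast Fintype.card_pos
  refine ⟨j, hj, G × ZMod (2 * N), inferInstance, inferInstance, inferInstance,
    A ×ˢ (B j).image (fun x : ℤ => (x : ZMod (2 * N))), (g, 1), ?_, B j,
    Finset.inter_subset_left, fun z hz θ hθ => ?_⟩
  · rw [hcG, Finset.card_product, card_image_zmod_cast hBsub, Nat.cast_mul]
    calc δ * (κ / (2 * r)) * (Fintype.card G * (2 * N))
        = (δ * Fintype.card G) * (κ * N / r) := by field_simp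
      _ ≤ #A * #(B j) := by gcongr
  · rw [Prod.smul_mk, returnCount_prod, hcG, Nat.cast_mul] at hθ
    set a := returnCount A (z ^ 2 • g)
    set b := returnCount ((B j).image (fun x : ℤ => (x : ZMod (2 * N)))) (z ^ 2 • 1)
    have ha : (a : ℝ) ≤ Fintype.card G := by exact_mod_cast returnCount_le_card _ _
    have hb : (b : ℝ) ≤ 2 * N := by
      have : b ≤ 2 * N := (returnCount_le_card _ _).trans_eq (ZMod.card _)
      exact_mod_cast this
    have hbB : (b : ℝ) ≤ returnCount (B j) ((z : ℤ) ^ 2) := by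
      exact_mod_cast returnCount_image_zmod_cast_le hBsub hz
    -- Each factor's count is at most the order of its group, so the proportion `θ` of the product
    -- passes to both factors.
    constructor
    · have : θ * Fintype.card G * (2 * N) ≤ a * (2 * N) := by
        calc _ = θ * (Fintype.card G * (2 * N)) := by ring
          _ ≤ a * b := hθ
          _ ≤ _ := by gcongr
      exact le_of_mul_le_mul_right this (by positivity)
    · have : (θ * (2 * N)) * Fintype.card G ≤ b * Fintype.card G := by
        calc _ = θ * (Fintype.card G * (2 * N)) := by ring
          _ ≤ a * b := hθ
          _ ≤ Fintype.card G * b := by gcongr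
          _ = _ := by ring
      have h3 := le_of_mul_le_mul_right this hG
      rcases le_or_gt 0 θ with h0 | h0
      · nlinarith
      · have : 0 ≤ (returnCount (B j) ((z : ℤ) ^ 2) : ℝ) := by positivity
        nlinarith

/-! ### Induction on the number of colours -/

theorem le_two_mul_sqrt_sq {N : ℕ} (hN : 1 ≤ N) : N ≤ (2 * Nat.sqrt N) ^ 2 := by
  have h2 := Nat.lt_succ_sqrt' N
  have h3 : 1 ≤ Nat.sqrt N := Nat.le_sqrt'.2 (by simpa using hN)
  have : Nat.succ (Nat.sqrt N) ≤ 2 * Nat.sqrt N := by omega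
  exact h2.le.trans (Nat.pow_le_pow_left this 2)

theorem rpow_le_sqrt_rpow {N r : ℕ} (hN : 1 ≤ N) :
    (N : ℝ) ^ ((3 : ℝ) / 2 ^ (r + 1)) ≤ 8 * (Nat.sqrt N : ℝ) ^ ((3 : ℝ) / 2 ^ r) := by
  have h1 : (N : ℝ) ≤ (2 * Nat.sqrt N : ℝ) ^ 2 := by exact_mod_cast le_two_mul_sqrt_sq hN
  have he : (3 : ℝ) / 2 ^ r ≤ 3 := div_le_self (by norm_num) (one_le_pow₀ (by norm_num))
  calc (N : ℝ) ^ ((3 : ℝ) / 2 ^ (r + 1))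
      ≤ ((2 * Nat.sqrt N : ℝ) ^ 2) ^ ((3 : ℝ) / 2 ^ (r + 1)) := by gcongr
    _ = (2 * Nat.sqrt N : ℝ) ^ ((3 : ℝ) / 2 ^ r) := by
      rw [← Real.rpow_natCast, ← Real.rpow_mul (by positivity)]
      congr 1
      rw [pow_succ]; field_simp; norm_num
    _ = 2 ^ ((3 : ℝ) / 2 ^ r) * (Nat.sqrt N : ℝ) ^ ((3 : ℝ) / 2 ^ r) :=
      Real.mul_rpow (by norm_num) (by positivity)
    _ ≤ _ := by
      gcongr
      calc (2 : ℝ) ^ ((3 : ℝ) / 2 ^ r) ≤ 2 ^ (3 : ℝ) :=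
            Real.rpow_le_rpow_of_exponent_le (by norm_num) he
        _ = 8 := by norm_num

/-- If the square return times of a dense set are covered by `r + 1` sets, one of them contains
many solutions of `x - y = z ^ 2`. -/
theorem exists_bergelsonCount_ge_of_cover_returnTimes (r : ℕ) : ∀ {δ : ℝ}, 0 < δ →
    ∃ c : ℝ, 0 < c ∧ ∃ η : ℝ, 0 < η ∧ ∃ N₀ : ℕ,
      ∀ (G : Type) [AddCommGroup G] [Fintype G] [DecidableEq G]
      (A : Finset G) (g : G), δ * Fintype.card G ≤ #A → ∀ N, N₀ ≤ N →
      ∀ (ι : Type) (s : Finset ι) (C : ι → Finset ℤ), #s = r + 1 →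
      (∀ z ∈ Icc 1 N, η * Fintype.card G ≤ (returnCount A (z ^ 2 • g) : ℝ) →
        ∃ j ∈ s, (z : ℤ) ∈ C j) →
      ∃ j ∈ s, c * (N : ℝ) ^ ((3 : ℝ) / 2 ^ (r + 1)) ≤ bergelsonCount (C j) := by
  classical
  induction r with
  | zero =>
    intro δ hδ
    obtain ⟨δ', hδ', N₀, hN₀, h⟩ := exists_dense_class_and_product hδ 1 le_rfl
    obtain ⟨κ, hκ, N₁, h'⟩ := exists_card_returnTimes_ge hδ'
    -- The cover must include the return times of `A` and those of the product set, hence the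
    -- smaller threshold. `N₁ ^ 2` ensures `N₁ ≤ Nat.sqrt N`.
    refine ⟨κ * (δ' ^ 2 / 2) / 2, by positivity, min (δ ^ 2 / 2) (δ' ^ 2 / 2), by positivity,
      max N₀ (N₁ ^ 2), fun G _ _ _ A g hA N hN ι s C hs hcov => ?_⟩
    obtain ⟨j, hj, G', _, _, _, A', g', hA', B, hB, hret⟩ :=
      h G A g hA N (le_trans (le_max_left _ _) hN) ι s C hs
        fun z hz hz' => hcov z hz (le_trans (by gcongr; exact min_le_left _ _) hz')
    refine ⟨j, hj, ?_⟩
    have hN1 : 1 ≤ N := hN₀.trans (le_trans (le_max_left _ _) hN)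
    have hcard := h' G' A' g' hA' (Nat.sqrt N) (Nat.le_sqrt'.2 (le_trans (le_max_right _ _) hN))
    set Z := {z ∈ Icc 1 (Nat.sqrt N) |
      δ' ^ 2 / 2 * Fintype.card G' ≤ (returnCount A' (z ^ 2 • g') : ℝ)} with hZ
    have hZr : ∀ z ∈ Z, (z : ℤ) ∈ C j ∧ δ' ^ 2 / 2 * N ≤ returnCount B ((z : ℤ) ^ 2) := by
      intro z hz
      rw [hZ, mem_filter, mem_Icc] at hz
      have hzN : z ^ 2 ≤ N := Nat.le_sqrt'.1 hz.1.2
      obtain ⟨h1, h2⟩ := hret z hzN _ hz.2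
      refine ⟨?_, h2⟩
      obtain ⟨i, hi, hzi⟩ := hcov z (mem_Icc.2 ⟨hz.1.1, hz.1.2.trans (Nat.sqrt_le_self N)⟩)
        (le_trans (by gcongr; exact min_le_right _ _) h1)
      rwa [Finset.card_le_one.1 hs.le j hj i hi]
    have hsum := sum_returnCount_le_bergelsonCount (C j) B hB Z fun z hz => (hZr z hz).1
    calc κ * (δ' ^ 2 / 2) / 2 * (N : ℝ) ^ ((3 : ℝ) / 2 ^ (0 + 1))
        ≤ κ * (δ' ^ 2 / 2) / 2 * (N * (2 * Nat.sqrt N)) := by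
          gcongr
          have h1 : (N : ℝ) ≤ (2 * Nat.sqrt N : ℝ) ^ 2 := by exact_mod_cast le_two_mul_sqrt_sq hN1
          have h2 : (3 : ℝ) / 2 ^ (0 + 1) = 1 + 1 / 2 := by norm_num
          rw [h2, Real.rpow_add (by exact_mod_cast hN1), Real.rpow_one, ← Real.sqrt_eq_rpow]
          gcongr
          exact Real.sqrt_le_iff.2 ⟨by positivity, h1⟩
      _ = (κ * Nat.sqrt N) * (δ' ^ 2 / 2 * N) := by ring
      _ ≤ #Z * (δ' ^ 2 / 2 * N) := by gcongr
      _ = ∑ z ∈ Z, (δ' ^ 2 / 2 * N) := by simp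
      _ ≤ ∑ z ∈ Z, (returnCount B ((z : ℤ) ^ 2) : ℝ) :=
        Finset.sum_le_sum fun z hz => (hZr z hz).2
      _ ≤ bergelsonCount (C j) := by exact_mod_cast hsum
  | succ r ih =>
    intro δ hδ
    obtain ⟨δ', hδ', N₀, hN₀, h⟩ := exists_dense_class_and_product hδ (r + 2) (by omega)
    obtain ⟨c, hc, η, hη, N₁, h'⟩ := ih hδ'
    refine ⟨min η (c / 8), by positivity, min (δ ^ 2 / 2) η, by positivity,
      max N₀ (N₁ ^ 2), fun G _ _ _ A g hA N hN ι s C hs hcov => ?_⟩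
    obtain ⟨j, hj, G', _, _, _, A', g', hA', B, hB, hret⟩ :=
      h G A g hA N (le_trans (le_max_left _ _) hN) ι s C hs
        fun z hz hz' => hcov z hz (le_trans (by gcongr; exact min_le_left _ _) hz')
    have hN1 : 1 ≤ N := hN₀.trans (le_trans (le_max_left _ _) hN)
    -- Either one product return time has colour `j`, and this single `z` suffices, or colour `j`
    -- can be dropped from the cover up to `√N`.
    by_cases hex : ∃ z ∈ Icc 1 (Nat.sqrt N),
        η * Fintype.card G' ≤ (returnCount A' (z ^ 2 • g') : ℝ) ∧ (z : ℤ) ∈ C j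
    · obtain ⟨z, hz, hzr, hzC⟩ := hex
      refine ⟨j, hj, ?_⟩
      have hzN : z ^ 2 ≤ N := Nat.le_sqrt'.1 (mem_Icc.1 hz).2
      have hsum := sum_returnCount_le_bergelsonCount (C j) B hB {z} (by simpa using hzC)
      rw [Finset.sum_singleton] at hsum
      -- At least two colours remain, so order `N` exceeds what is required.
      have he : (3 : ℝ) / 2 ^ (r + 1 + 1) ≤ 1 := by
        rw [div_le_one (by positivity)]
        have : (1 : ℝ) ≤ 2 ^ r := one_le_pow₀ (by norm_num)
        rw [pow_succ, pow_succ]; linarith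
      calc min η (c / 8) * (N : ℝ) ^ ((3 : ℝ) / 2 ^ (r + 1 + 1)) ≤ η * (N : ℝ) ^ (1 : ℝ) := by
            gcongr
            · exact min_le_left _ _
            · exact_mod_cast hN1
        _ = η * N := by rw [Real.rpow_one]
        _ ≤ returnCount B ((z : ℤ) ^ 2) := (hret z hzN _ hzr).2
        _ ≤ bergelsonCount (C j) := by exact_mod_cast hsum
    · push Not at hex
      obtain ⟨i, hi, hci⟩ := h' G' A' g' hA' (Nat.sqrt N)
        (Nat.le_sqrt'.2 (le_trans (le_max_right _ _) hN)) ι (s.erase j) C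
        (by rw [Finset.card_erase_of_mem hj, hs]; rfl) (by
          intro z hz hzr
          have hz' := mem_Icc.1 hz
          obtain ⟨i, hi, hzi⟩ := hcov z (mem_Icc.2 ⟨hz'.1, hz'.2.trans (Nat.sqrt_le_self N)⟩)
            (le_trans (by gcongr; exact min_le_right _ _)
              (hret z (Nat.le_sqrt'.1 hz'.2) _ hzr).1)
          refine ⟨i, mem_erase.2 ⟨?_, hi⟩, hzi⟩
          rintro rfl
          exact hex z hz hzr hzi)
      refine ⟨i, mem_of_mem_erase hi, le_trans ?_ hci⟩
      calc min η (c / 8) * (N : ℝ) ^ ((3 : ℝ) / 2 ^ (r + 1 + 1))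
          ≤ c / 8 * (8 * (Nat.sqrt N : ℝ) ^ ((3 : ℝ) / 2 ^ (r + 1))) := by
            gcongr
            · exact min_le_right _ _
            · exact rpow_le_sqrt_rpow hN1
        _ = _ := by ring

theorem exists_bergelsonCount_ge_of_isColouring (r : ℕ) (hr : 1 ≤ r) :
    ∃ c : ℝ, 0 < c ∧ ∃ N₀ : ℕ, ∀ N, N₀ ≤ N → ∀ C : Fin r → Finset ℤ, IsColouring N C →
      ∃ j, c * (N : ℝ) ^ ((3 : ℝ) / 2 ^ r) ≤ bergelsonCount (C j) := by
  obtain ⟨r, rfl⟩ := Nat.exists_eq_add_of_le' hr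
  obtain ⟨c, hc, η, -, N₀, h⟩ := exists_bergelsonCount_ge_of_cover_returnTimes r one_pos
  refine ⟨c, hc, N₀, fun N hN C hC => ?_⟩
  -- In the trivial group every `z` is a return time, so the cover is the colouring itself.
  obtain ⟨j, -, hj⟩ := h (ZMod 1) univ 0 (by simp) N hN (Fin (r + 1)) univ C (by simp) (by
    intro z hz _
    have hz' := mem_Icc.1 hz
    have : (z : ℤ) ∈ univ.biUnion C := by
      rw [hC.2, mem_Icc]; omega
    simpa using this)
  exact ⟨j, hj⟩

/-! ### The extremal colouring -/

/-- The colour of `x` in the colouring of `[N]` by iterated square roots of `N`. -/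
def sqrtColour (N r : ℕ) (x : ℤ) : ℕ :=
  Nat.findGreatest (fun j => x.toNat ^ 2 ^ j ≤ N) (r - 1)

/-- The colour classes of `sqrtColour`. -/
noncomputable def sqrtClass (N r : ℕ) (j : Fin r) : Finset ℤ :=
  {x ∈ Icc (1 : ℤ) N | sqrtColour N r x = j}

theorem isColouring_sqrtClass (N r : ℕ) (hr : 1 ≤ r) : IsColouring N (sqrtClass N r) := by
  constructor
  · intro i j hij
    rw [Finset.disjoint_left]
    intro x hi hj
    simp only [sqrtClass, mem_filter] at hi hj
    exact hij (Fin.ext (hi.2.symm.trans hj.2))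
  · ext x
    simp only [sqrtClass, mem_biUnion, mem_univ, true_and, mem_filter]
    constructor
    · rintro ⟨_, h, _⟩
      exact h
    · intro h
      refine ⟨⟨sqrtColour N r x, ?_⟩, h, rfl⟩
      have : sqrtColour N r x ≤ r - 1 := Nat.findGreatest_le _
      omega

theorem pow_le_of_mem_sqrtClass {N r : ℕ} {j : Fin r} {x : ℤ} (hx : x ∈ sqrtClass N r j) :
    x.toNat ^ 2 ^ (j : ℕ) ≤ N := by
  rw [sqrtClass, mem_filter, mem_Icc, sqrtColour] at hx
  rw [← hx.2]
  -- Index `0` satisfies the predicate because `x ≤ N`, so the default value of `Nat.findGreatest`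
  -- is harmless.
  refine Nat.findGreatest_spec (P := fun j => x.toNat ^ 2 ^ j ≤ N) (Nat.zero_le _) ?_
  simp only [pow_zero, pow_one]
  omega

theorem lt_pow_of_mem_sqrtClass {N r : ℕ} {j : Fin r} {x : ℤ} (hx : x ∈ sqrtClass N r j)
    (hj : (j : ℕ) + 1 < r) : N < x.toNat ^ 2 ^ ((j : ℕ) + 1) := by
  rw [sqrtClass, mem_filter, sqrtColour] at hx
  have := Nat.findGreatest_is_greatest (P := fun j => x.toNat ^ 2 ^ j ≤ N) (n := r - 1)
    (k := (j : ℕ) + 1) (by omega) (by omega)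
  simpa using this

/-- In a solution of `x - y = z ^ 2` in positive integers, `z ^ 2 < x`. -/
theorem toNat_sq_lt_of_sub_eq {x y z : ℤ} (hy : 1 ≤ y) (hz : 1 ≤ z) (h : x - y = z ^ 2) :
    z.toNat ^ 2 < x.toNat := by
  zify
  rw [Int.toNat_of_nonneg (by omega), Int.toNat_of_nonneg (by nlinarith)]
  omega

/-- Outside the last class, `x ^ 2 ^ j ≤ N < z ^ 2 ^ (j + 1)` gives `x < z ^ 2`, which no solution
allows. -/
theorem bergelsonCount_sqrtClass_eq_zero {N r : ℕ} {j : Fin r} (hj : (j : ℕ) + 1 < r) :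
    bergelsonCount (sqrtClass N r j) = 0 := by
  rw [bergelsonCount, Finset.card_eq_zero, Finset.filter_eq_empty_iff]
  rintro ⟨x, y, z⟩ hp h
  simp only [mem_product] at hp h
  obtain ⟨hx, hy, hz⟩ := hp
  have hy1 := (mem_Icc.1 (mem_filter.1 hy).1).1
  have hz1 := (mem_Icc.1 (mem_filter.1 hz).1).1
  have h1 := toNat_sq_lt_of_sub_eq hy1 hz1 h
  have h2 := lt_pow_of_mem_sqrtClass hz hj
  have h3 := pow_le_of_mem_sqrtClass hx
  have h4 : z.toNat ^ 2 ^ ((j : ℕ) + 1) ≤ x.toNat ^ 2 ^ (j : ℕ) := by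
    rw [pow_succ', pow_mul]
    exact Nat.pow_le_pow_left h1.le _
  omega

/-- A set of positive integers below `X` has at most `X ^ (3 / 2)` solutions of
`x - y = z ^ 2`. -/
theorem bergelsonCount_le_rpow {A : Finset ℤ} {X : ℝ} (hX : 0 ≤ X)
    (hA : ∀ x ∈ A, 1 ≤ x ∧ (x : ℝ) ≤ X) : (bergelsonCount A : ℝ) ≤ X ^ ((3 : ℝ) / 2) := by
  have h : bergelsonCount A ≤ #(Icc 1 ⌊X⌋₊ ×ˢ Icc 1 ⌊√X⌋₊) := by
    -- A solution is determined by `x ≤ X` and `z ≤ √X`.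
    refine Finset.card_le_card_of_injOn (fun p => (p.1.toNat, p.2.2.toNat)) ?_ ?_
    · rintro ⟨x, y, z⟩ hp
      simp only [coe_filter, mem_product, Set.mem_ofPred_eq] at hp
      obtain ⟨⟨hx, hy, hz⟩, h⟩ := hp
      have hx' := hA x hx
      have hy' := hA y hy
      have hz' := hA z hz
      simp only [coe_product, Set.mem_prod, mem_coe, mem_Icc]
      have hxc : ((x.toNat : ℕ) : ℝ) = x := by
        exact_mod_cast Int.toNat_of_nonneg (by omega : 0 ≤ x)
      have h1 := toNat_sq_lt_of_sub_eq hy'.1 hz'.1 h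
      have h1' : ((z.toNat : ℕ) : ℝ) ^ 2 ≤ x := by rw [← hxc]; exact_mod_cast h1.le
      refine ⟨⟨by omega, Nat.le_floor (by rw [hxc]; exact hx'.2)⟩, by omega, Nat.le_floor ?_⟩
      exact Real.le_sqrt_of_sq_le (h1'.trans hx'.2)
    · rintro ⟨x, y, z⟩ hp ⟨x', y', z'⟩ hp' heq
      simp only [coe_filter, mem_product, Set.mem_ofPred_eq] at hp hp'
      simp only [Prod.mk.injEq] at heq ⊢
      have h1 := hA _ hp.1.1
      have h2 := hA _ hp.1.2.2
      have h3 := hA _ hp'.1.1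
      have h4 := hA _ hp'.1.2.2
      obtain rfl : x = x' := by omega
      obtain rfl : z = z' := by omega
      exact ⟨rfl, by omega, rfl⟩
  rw [Finset.card_product, Nat.card_Icc, Nat.card_Icc, Nat.add_sub_cancel,
    Nat.add_sub_cancel] at h
  calc (bergelsonCount A : ℝ) ≤ (⌊X⌋₊ : ℝ) * ⌊√X⌋₊ := by exact_mod_cast h
    _ ≤ X * √X := by
      gcongr
      · exact Nat.floor_le hX
      · exact Nat.floor_le (Real.sqrt_nonneg X)
    _ = X ^ ((3 : ℝ) / 2) := by
      rw [Real.sqrt_eq_rpow, show (3 : ℝ) / 2 = 1 + 1 / 2 by norm_num,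
        Real.rpow_add' hX (by norm_num), Real.rpow_one]

theorem sum_bergelsonCount_sqrtClass_le (N r : ℕ) (hr : 1 ≤ r) :
    ((∑ j : Fin r, bergelsonCount (sqrtClass N r j) : ℕ) : ℝ) ≤ (N : ℝ) ^ ((3 : ℝ) / 2 ^ r) := by
  obtain ⟨r, rfl⟩ := Nat.exists_eq_add_of_le' hr
  rw [Finset.sum_eq_single (Fin.last r)]
  · have h := bergelsonCount_le_rpow (A := sqrtClass N (r + 1) (Fin.last r))
      (X := (N : ℝ) ^ ((1 : ℝ) / 2 ^ r)) (by positivity) (by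
        intro x hx
        have hx1 := (mem_Icc.1 (mem_filter.1 hx).1).1
        refine ⟨hx1, ?_⟩
        have h1 := pow_le_of_mem_sqrtClass hx
        have hxc : ((x.toNat : ℕ) : ℝ) = x := by
          exact_mod_cast Int.toNat_of_nonneg (by omega : 0 ≤ x)
        have h2 : (x : ℝ) ^ 2 ^ r ≤ N := by
          rw [← hxc]; simpa using (Nat.cast_le (α := ℝ)).2 h1
        have hx0 : (0 : ℝ) ≤ x := by rw [← hxc]; positivity
        calc (x : ℝ) = ((x : ℝ) ^ 2 ^ r) ^ ((1 : ℝ) / 2 ^ r) := by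
              rw [← Real.rpow_natCast, ← Real.rpow_mul hx0]
              push_cast
              rw [mul_one_div_cancel (by positivity), Real.rpow_one]
          _ ≤ _ := by gcongr)
    rw [← Real.rpow_mul (by positivity)] at h
    convert h using 2
    rw [pow_succ]; field_simp
  · intro j _ hj
    apply bergelsonCount_sqrtClass_eq_zero
    have h1 : (j : ℕ) ≠ r := fun h => hj (Fin.ext h)
    omega
  · simp

theorem mainTheorem5 :
    (∀ r : ℕ, 1 ≤ r →
      ∃ c : ℝ, 0 < c ∧
      ∃ ε : ℕ → ℝ, Filter.Tendsto ε Filter.atTop (nhds 0) ∧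
      ∀ (N : ℕ) (C : Fin r → Finset ℤ), IsColouring N C →
        ∃ j : Fin r,
          c * ((N : ℝ) ^ ((3 : ℝ) / 2 ^ r) * (1 - ε N)) ≤ (bergelsonCount (C j) : ℝ)) ∧
    (∃ K : ℝ, ∀ r : ℕ, 1 ≤ r → ∀ N : ℕ,
      ∃ C : Fin r → Finset ℤ, IsColouring N C ∧
        ((∑ j : Fin r, bergelsonCount (C j) : ℕ) : ℝ) ≤ K * (N : ℝ) ^ ((3 : ℝ) / 2 ^ r)) := by
  refine ⟨fun r hr => ?_, 1, fun r hr N => ⟨sqrtClass N r, isColouring_sqrtClass N r hr, ?_⟩⟩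
  · obtain ⟨c, hc, N₀, h⟩ := exists_bergelsonCount_ge_of_isColouring r hr
    -- Below `N₀` the value `ε = 1` makes the bound zero.
    refine ⟨c, hc, fun N => if N₀ ≤ N then 0 else 1, ?_, fun N C hC => ?_⟩
    · refine tendsto_const_nhds.congr' ?_
      filter_upwards [Filter.eventually_ge_atTop N₀] with N hN
      simp [hN]
    · by_cases hN : N₀ ≤ N
      · simpa [hN] using h N hN C hC
      · exact ⟨⟨0, hr⟩, by simp [hN]⟩
  · simpa using sum_bergelsonCount_sqrtClass_le N r hr
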